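/- All actions are right actions, so a product $gh$ means "first $g$, then $h$". Let $H$ be a countable group of piecewise projective homeomorphisms of $\mathbb{R}$ (homeomorphisms that, off a finite set of breakpoints, agree on each interval with an element of $PSL_2(\mathbb{R})$ acting by fractional linear transformations). Let $\mathbf{F}\le PSL_2(\mathbb{R})$ be a non-discrete free subgroup, freely generated by $a,b$; fix a metric on $PSL_2(\mathbb{R})$ that induces its usual topology, and let $B_\delta(1_{\mathbf F})$ be the ball of radius $\delta$ in $\mathbf F$ about the identity. Let $I=[\alpha,\beta]$ be a compact interval in $\mathbb{R}$ with $\alpha<\beta$. Call a set $T=\{g_1,\dots,g_6\}\cup\{h_1,\dots,h_6\}\subset\mathbf{F}$ $\delta$-admissible if 1. each $g_i$ is given by a reduced word of the form $a^i w_i a^{-i}$, where the words $w_1,\dots,w_6$ all begin with the same (possibly trivial) power of $a$ (for instance all $w_i$ are the same word $w$, or every $w_i$ begins with $b$ or $b^{-1}$); 2. each $h_i$ is given by a reduced word of the form $b^i w_i' b^{-i}$, where the words $w_1',\dots,w_6'$ all begin with the same (possibly trivial) power of $b$; 3. $T\subset B_\delta(1_{\mathbf F})$; 4. no element of $T$ maps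 a point of $I$ to $\infty$. Then there is a $\delta>0$ such that $\delta$-admissible sets $T$ exist, and such that the following holds for every $\delta$-admissible $T$. If $\tilde T=\{\mathbf g_1,\dots,\mathbf g_6\}\cup\{\mathbf h_1,\dots,\mathbf h_6\}\subset H$, where $\mathbf g_i$ and $\mathbf h_i$ agree on $I$ with $g_i$ and $h_i$ respectively, then for every finite subset $u$ of $H$ $$|(\tilde T\cup\{1_H\})\cdot u|\ \ge\ 2|u| .$$ -/

import Mathlib

open scoped MatrixGroups Pointwise

noncomputable section

namespace PiecewiseProjective

/-- `PSL(2, ℝ)` acts on `ℝ ∪ {∞}` by fractional linear transformations, through the identification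
of `ℝ ∪ {∞}` with the projective line (`x ↦ [x : 1]`, `∞ ↦ [1 : 0]`). -/
instance : MulAction PSL(2, ℝ) (OnePoint ℝ) :=
  (OnePoint.equivProjectivization ℝ).mulAction PSL(2, ℝ)

/-- The class of `!![a, b; c, d]` acts on `ℝ ∪ {∞}` as `x ↦ (a x + b) / (c x + d)`. -/
theorem mk_smul_coe (A : SL(2, ℝ)) (x : ℝ) :
    (QuotientGroup.mk A : PSL(2, ℝ)) • (x : OnePoint ℝ) =
      if A 1 0 * x + A 1 1 = 0 then OnePoint.infty
      else (((A 0 0 * x + A 0 1) / (A 1 0 * x + A 1 1) : ℝ) : OnePoint ℝ) :=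
  (OnePoint.smul_some_eq_ite (g := (A : GL (Fin 2) ℝ)) (k := x) :)

/-- The topology of `PSL(2, ℝ)`: the quotient of the topology of `SL(2, ℝ)`. -/
@[reducible] def pslTopology : TopologicalSpace PSL(2, ℝ) := inferInstance

/-- The group of projective transformations of `ℝ ∪ {∞}` acting on the right: the product `g * h`
means first `g`, then `h`. -/
abbrev Proj : Type := (PSL(2, ℝ))ᵐᵒᵖ

/-- The group of homeomorphisms of the real line acting on the right: the product `g * h`
means first `g`, then `h`. -/
abbrev HomeoR : Type := (ℝ ≃ₜ ℝ)ᵐᵒᵖ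

/-- The right action `x · g` of `Proj` on `ℝ ∪ {∞}`. -/
def Proj.act (x : OnePoint ℝ) (g : Proj) : OnePoint ℝ := g.unop • x

/-- The right action `x · g` of `HomeoR` on `ℝ`. -/
def HomeoR.act (x : ℝ) (g : HomeoR) : ℝ := g.unop x

theorem Proj.act_mul (x : OnePoint ℝ) (g h : Proj) :
    Proj.act x (g * h) = Proj.act (Proj.act x g) h := by
  simp [Proj.act, mul_smul]

theorem HomeoR.act_mul (x : ℝ) (g h : HomeoR) :
    HomeoR.act x (g * h) = HomeoR.act (HomeoR.act x g) h := rfl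

/-- A homeomorphism of `ℝ` is piecewise projective if, for some finite set `B` of breakpoints, it
agrees with an element of `PSL(2, ℝ)` on every interval (bounded or not) that avoids `B`. -/
def IsPiecewiseProjective (f : HomeoR) : Prop :=
  ∃ B : Finset ℝ, ∀ J : Set ℝ, J.OrdConnected → Disjoint J (B : Set ℝ) →
    ∃ p : Proj, ∀ x ∈ J, ((HomeoR.act x f : ℝ) : OnePoint ℝ) = Proj.act x p

/-- `g` (acting on `ℝ`) and `p` (acting on `ℝ ∪ {∞}`) agree on `[lo, hi]`. -/
def AgreeOn (lo hi : ℝ) (g : HomeoR) (p : Proj) : Prop :=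
  ∀ x ∈ Set.Icc lo hi, ((HomeoR.act x g : ℝ) : OnePoint ℝ) = Proj.act x p

/-- The group `F` is freely generated by `a` and `b`. -/
structure FreelyGeneratedBy (F : Subgroup Proj) (a b : Proj) : Prop where
  generates : Subgroup.closure {a, b} = F
  free : Function.Injective (FreeGroup.lift ![a, b] : FreeGroup (Fin 2) →* Proj)

/-- `F` is not discrete as a subspace of `PSL(2, ℝ)`. -/
def NonDiscrete (F : Subgroup Proj) : Prop :=
  ¬ @DiscreteTopology F (TopologicalSpace.induced (fun g : F => (g : Proj).unop) pslTopology)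

/-- Words in the letters `0, 1` (standing for `a, b`) and their inverses; the letter
`(c, true)` is the generator `c`, the letter `(c, false)` its inverse. -/
abbrev Word : Type := List (Fin 2 × Bool)

/-- The word `c ^ k w c ^ (-k)`, written out without cancellation. -/
def conjWord (c : Fin 2) (k : ℕ) (w : Word) : Word :=
  List.replicate k (c, true) ++ w ++ List.replicate k (c, false)

/-- The longest initial segment of `w` that consists of letters `c ^ (± 1)`. -/
def initialRun (c : Fin 2) (w : Word) : Word := w.takeWhile fun l => l.1 = c

/-- `g 0, …, g 5` are the reduced words `c ^ i w_i c ^ (-i)`, `i = 1, …, 6`, where the words `w_i`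
begin with the same power of `c`: for instance one and the same word `w`, or words
that all begin with the other generator or its inverse. -/
def IsConjFamily (c : Fin 2) (g : Fin 6 → FreeGroup (Fin 2)) : Prop :=
  ∃ w : Fin 6 → Word,
    (∀ i : Fin 6, FreeGroup.IsReduced (conjWord c (i.val + 1) (w i))) ∧
    (∀ i : Fin 6, g i = FreeGroup.mk (conjWord c (i.val + 1) (w i))) ∧
    ∀ i j, initialRun c (w i) = initialRun c (w j)

/-- The element of the group generated by `a` and `b` that a word represents. -/
abbrev evalWord (a b : Proj) (g : FreeGroup (Fin 2)) : Proj := FreeGroup.lift ![a, b] g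

/-- The set `T = {g_1, …, g_6} ∪ {h_1, …, h_6}` of words: `g_i` is a reduced word `a^i w a^(-i)`,
`h_i` is a reduced word `b^i w' b^(-i)`, and the elements they represent are at distance less
than `δ` from the identity and map `[lo, hi]` into `ℝ`. -/
structure IsWordChoice (m : MetricSpace PSL(2, ℝ)) (a b : Proj) (lo hi δ : ℝ)
    (g h : Fin 6 → FreeGroup (Fin 2)) : Prop where
  form_g : IsConjFamily 0 g
  form_h : IsConjFamily 1 h
  small_g : ∀ i, m.dist (evalWord a b (g i)).unop 1 < δ
  small_h : ∀ i, m.dist (evalWord a b (h i)).unop 1 < δ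
  regular_g : ∀ i, ∀ x ∈ Set.Icc lo hi, Proj.act (x : ℝ) (evalWord a b (g i)) ≠ OnePoint.infty
  regular_h : ∀ i, ∀ x ∈ Set.Icc lo hi, Proj.act (x : ℝ) (evalWord a b (h i)) ≠ OnePoint.infty

end PiecewiseProjective

end

/-! ### Reduced words and conjugate families in the free group. -/

namespace PiecewiseProjective

open FreeGroup

/-! The proof is a measure count on I, whose length is L. For k in u and almost every y in I, let k₀
be the first element of u, in a fixed enumeration, such that y·k k₀⁻¹ lies in the F-orbit of y.
Nontrivial elements of F fix finitely many points, so off a countable set y·k k₀⁻¹ = y·w for a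
unique w in F. Since w cannot begin with letters of both kinds, the two sets P_c(k) (`piece`), c =
a, b, where w does not begin with c^{±1}, cover almost all of I. Let Z(c,i,k) be the preimage in I
of P_c(k) under the i-th element t of the c-family.

For fixed l, the sets Z(c,i,k) with t k = l are disjoint. On I, t acts as a word v, so x and x·t
have the same F-orbit; hence k₀ depends only on x and l (`mul_eq_mul_of_mem_piece`), and so does the
word v w. There is no cancellation in v w, so its first letter reveals c and the length of its
initial run reveals i. Thus the measures of all Z sum to at most L times the number of products.

Near the identity, t is 4/3-Lipschitz and moves points of I by at most L/8, so |Z(c,i,k)| ≥ 3/4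
(|P_c(k)| - L/4) (`volume_real_le_of_lipschitzOnWith`). Summing over i and c gives at least 6 · 3/4
· (L - L/2) = 9/4 L for each k, so there are at least 9/4 |u| products.

Non-discreteness supplies the families: a nontrivial word close enough to 1 stays small under the
finitely many conjugations needed. -/

/-- The reduced word of `v` does not start with a letter `c ^ (± 1)`. -/
def NotStart (c : Fin 2) (v : FreeGroup (Fin 2)) : Prop := ∀ y ∈ v.toWord.head?, y.1 ≠ c

theorem notStart_zero_or_one (v : FreeGroup (Fin 2)) : NotStart 0 v ∨ NotStart 1 v := by
  unfold NotStart
  rcases v.toWord.head? with _ | y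
  · simp
  · simp only [Option.mem_def, Option.some.injEq, forall_eq']
    omega

theorem exists_forall_eq_of_isReduced {c : Fin 2} :
    ∀ {L : Word}, IsReduced L → (∀ l ∈ L, l.1 = c) → ∃ s, ∀ l ∈ L, l = (c, s)
  | [], _, _ => ⟨true, by simp⟩
  | [x], _, hc => ⟨x.2, by simpa [Prod.ext_iff] using hc⟩
  | x :: y :: L, hL, hc => by
    obtain ⟨hxy, hL'⟩ := List.isChain_cons_cons.1 hL
    obtain ⟨s, hs⟩ := exists_forall_eq_of_isReduced hL' fun l hl => hc l (List.mem_cons_of_mem _ hl)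
    refine ⟨s, fun l hl => ?_⟩
    rcases List.mem_cons.1 hl with rfl | hl
    · have hx := hc l (by simp)
      have hy := hs y (by simp)
      have h2 := hxy (by rw [hx, hc y (by simp)])
      rw [hy] at h2
      exact Prod.ext hx h2
    · exact hs l hl

/-- A reduced word in the single generator c has constant sign, whereas the conjugate contains both
c and c⁻¹. -/
theorem exists_ne_of_isReduced_conjWord {c : Fin 2} {k : ℕ} {w : Word}
    (h : IsReduced (conjWord c (k + 1) w)) : ∃ l ∈ w, l.1 ≠ c := by
  by_contra! hw
  obtain ⟨s, hs⟩ := exists_forall_eq_of_isReduced h (c := c) (by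
    intro l hl
    simp only [conjWord, List.mem_append, List.mem_replicate] at hl
    rcases hl with (⟨-, rfl⟩ | hl) | ⟨-, rfl⟩
    · rfl
    · exact hw l hl
    · rfl)
  have h1 := hs (c, true) (by simp [conjWord])
  have h2 := hs (c, false) (by simp [conjWord])
  simp only [Prod.mk.injEq, true_and] at h1 h2
  exact absurd (h1.trans h2.symm) (by simp)

theorem initialRun_conjWord_append {c : Fin 2} {k : ℕ} {w : Word}
    (h : IsReduced (conjWord c (k + 1) w)) (v : Word) :
    initialRun c (conjWord c (k + 1) w ++ v) =
      List.replicate (k + 1) (c, true) ++ initialRun c w := by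
  obtain ⟨l, hl, hlc⟩ := exists_ne_of_isReduced_conjWord h
  simp only [initialRun, conjWord, List.append_assoc]
  rw [List.takeWhile_append_of_pos (by simp), List.takeWhile_append, if_neg]
  intro hlen
  have heq := (List.takeWhile_prefix (l := w) fun l => decide (l.1 = c)).eq_of_length hlen
  rw [← heq] at hl
  exact hlc (by simpa using List.mem_takeWhile_imp hl)

theorem toWord_mk_conjWord_mul {c : Fin 2} {k : ℕ} {w : Word}
    (h : IsReduced (conjWord c (k + 1) w)) {v : FreeGroup (Fin 2)} (hv : NotStart c v) :
    (FreeGroup.mk (conjWord c (k + 1) w) * v).toWord = conjWord c (k + 1) w ++ v.toWord := by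
  rw [toWord_mul, toWord_mk, h.reduce_eq]
  refine IsReduced.reduce_eq (List.isChain_append.2 ⟨h, isReduced_toWord, ?_⟩)
  intro x hx y hy hxy
  have : x = (c, false) := by
    simp [conjWord, List.getLast?_append, List.getLast?_replicate] at hx
    exact hx.symm
  exact absurd (by rw [← hxy, this]) (hv y hy)

/-- The initial c-run of the product ends inside w_i, so its length is the exponent plus a constant
common to the family; it determines the index. -/
theorem IsConjFamily.eq_of_mul_eq {c : Fin 2} {g : Fin 6 → FreeGroup (Fin 2)}
    (hg : IsConjFamily c g) {i j : Fin 6} {v v' : FreeGroup (Fin 2)} (hv : NotStart c v)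
    (hv' : NotStart c v') (h : g i * v = g j * v') : i = j ∧ v = v' := by
  obtain ⟨w, hred, hgw, hrun⟩ := hg
  have h1 := congrArg (fun z => (initialRun c (toWord z)).length) h
  simp only [hgw, toWord_mk_conjWord_mul (hred _) hv, toWord_mk_conjWord_mul (hred _) hv',
    initialRun_conjWord_append (hred _), hrun i j, List.length_append, List.length_replicate] at h1
  obtain rfl : i = j := by omega
  exact ⟨rfl, mul_left_cancel h⟩

theorem IsConjFamily.head?_toWord_mul {c : Fin 2} {g : Fin 6 → FreeGroup (Fin 2)}
    (hg : IsConjFamily c g) (i : Fin 6) {v : FreeGroup (Fin 2)} (hv : NotStart c v) :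
    (g i * v).toWord.head? = some (c, true) := by
  obtain ⟨w, hred, hgw, -⟩ := hg
  rw [hgw, toWord_mk_conjWord_mul (hred i) hv]
  simp [conjWord, List.replicate_succ]

theorem isReduced_conjWord {c : Fin 2} {w : Word} (hw : IsReduced w) (hne : w ≠ [])
    (hhead : ∀ x ∈ w.head?, x.1 ≠ c) (hlast : ∀ x ∈ w.getLast?, x.1 ≠ c) (k : ℕ) :
    IsReduced (conjWord c k w) := by
  refine List.isChain_append.2 ⟨List.isChain_append.2
    ⟨List.isChain_replicate_of_rel _ (by simp), hw, ?_⟩,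
    List.isChain_replicate_of_rel _ (by simp), ?_⟩
  · intro x hx y hy hxy
    have hx' := List.eq_of_mem_replicate (List.mem_of_getLast? hx)
    exact absurd (by rw [← hxy, hx']) (hhead y hy)
  · intro x hx y hy hxy
    rw [List.getLast?_append_of_ne_nil _ hne] at hx
    have hy' := List.eq_of_mem_replicate (List.mem_of_head? hy)
    exact absurd (by rw [hxy, hy']) (hlast x hx)

theorem exists_conj_toWord_ends {c d : Fin 2} (hcd : d ≠ c) {v : FreeGroup (Fin 2)} (hv : v ≠ 1) :
    ∃ q ∈ ({1, FreeGroup.mk [(d, true)], FreeGroup.mk [(d, false)]} : Set (FreeGroup (Fin 2))),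
      (q * v * q⁻¹).toWord ≠ [] ∧ (∀ x ∈ (q * v * q⁻¹).toWord.head?, x.1 ≠ c) ∧
        ∀ x ∈ (q * v * q⁻¹).toWord.getLast?, x.1 ≠ c := by
  have hne : v.toWord ≠ [] := by simpa using hv
  obtain ⟨x, hx⟩ : ∃ x, v.toWord.head? = some x := ⟨_, List.head?_eq_some_head hne⟩
  obtain ⟨y, hy⟩ : ∃ y, v.toWord.getLast? = some y := ⟨_, List.getLast?_eq_some_getLast hne⟩
  by_cases hxy : x.1 = d ∧ y.1 = d
  · refine ⟨1, by simp, ?_⟩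
    simp [hx, hy, hxy, hcd, hv]
  -- At most one end of v is a d-letter, so at most one end constrains the sign s that makes d^s v
  -- d^{-s} free of cancellation.
  · obtain ⟨s, hs1, hs2⟩ : ∃ s : Bool, (x.1 = d → x.2 = s) ∧ (y.1 = d → y.2 = !s) := by
      by_cases h : x.1 = d
      · exact ⟨x.2, fun _ => rfl, fun h' => absurd ⟨h, h'⟩ hxy⟩
      · exact ⟨!y.2, fun h' => absurd h' h, by simp⟩
    have hred : IsReduced ([(d, s)] ++ v.toWord ++ [(d, !s)]) := by
      refine List.isChain_append.2 ⟨List.isChain_append.2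
        ⟨List.isChain_singleton _, isReduced_toWord, ?_⟩, List.isChain_singleton _, ?_⟩
      · intro p hp q hq hpq
        simp only [hx, List.getLast?_singleton, Option.mem_def, Option.some.injEq] at hp hq
        subst hp hq
        exact (hs1 hpq.symm).symm
      · intro p hp q hq hpq
        rw [List.getLast?_append_of_ne_nil _ hne, hy] at hp
        simp only [List.head?_cons, Option.mem_def, Option.some.injEq] at hp hq
        subst hp hq
        exact hs2 hpq
    have heq : (FreeGroup.mk [(d, s)] * v * (FreeGroup.mk [(d, s)])⁻¹).toWord =
        [(d, s)] ++ v.toWord ++ [(d, !s)] := by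
      rw [← hred.reduce_eq, ← toWord_mk]
      conv_lhs => rw [← mk_toWord (x := v)]
      rw [inv_mk, mul_mk, mul_mk]
      simp [invRev]
    refine ⟨FreeGroup.mk [(d, s)], by cases s <;> simp, ?_⟩
    rw [heq]
    refine ⟨by simp, by simpa using hcd, ?_⟩
    rw [List.getLast?_concat]
    simpa using hcd

/-- Conjugating `v` by a suitable letter `q = d ^ (± 1)` (or not at all), and then by the powers of
`c`, gives a family of conjugates `c ^ i w c ^ (-i)` that are reduced as written. -/
theorem exists_isConjFamily {c d : Fin 2} (hcd : d ≠ c) {v : FreeGroup (Fin 2)} (hv : v ≠ 1) :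
    ∃ q ∈ ({1, FreeGroup.mk [(d, true)], FreeGroup.mk [(d, false)]} : Set (FreeGroup (Fin 2))),
      IsConjFamily c fun i => (of c ^ (i.val + 1) * q) * v * (of c ^ (i.val + 1) * q)⁻¹ := by
  obtain ⟨q, hq, hne, hhead, hlast⟩ := exists_conj_toWord_ends hcd hv
  refine ⟨q, hq, fun _ => (q * v * q⁻¹).toWord,
    fun i => isReduced_conjWord isReduced_toWord hne hhead hlast _, fun i => ?_, fun _ _ => rfl⟩
  have h1 : ∀ n : ℕ, of c ^ n = FreeGroup.mk (List.replicate n (c, true)) := fun n => by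
    rw [← toWord_of_pow, mk_toWord]
  have h2 : ∀ n : ℕ, (of c ^ n)⁻¹ = FreeGroup.mk (List.replicate n (c, false)) := fun n => by
    rw [h1, inv_mk]; simp [invRev]
  rw [conjWord, ← mul_mk, ← mul_mk, ← h1, ← h2, mk_toWord]
  group

end PiecewiseProjective

/-! ### Projective maps: estimates near the identity, fixed points, measurability. -/

namespace PiecewiseProjective

open Topology

/-- `p` has a representative whose entries are at distance less than `η` from those of `1`. -/
def IsNear (η : ℝ) (p : PSL(2, ℝ)) : Prop :=
  ∃ A : SL(2, ℝ), (QuotientGroup.mk A : PSL(2, ℝ)) = p ∧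
    |A 0 0 - 1| < η ∧ |A 0 1| < η ∧ |A 1 0| < η ∧ |A 1 1 - 1| < η

theorem isNear_mem_nhds_one {η : ℝ} (hη : 0 < η) : {p | IsNear η p} ∈ 𝓝 (1 : PSL(2, ℝ)) := by
  have hcont : ∀ i j, Continuous fun A : SL(2, ℝ) => A i j := fun i j =>
    (continuous_apply_apply i j).comp continuous_subtype_val
  have hU : IsOpen {A : SL(2, ℝ) |
      |A 0 0 - 1| < η ∧ |A 0 1| < η ∧ |A 1 0| < η ∧ |A 1 1 - 1| < η} := by
    have h00 := hcont 0 0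
    have h01 := hcont 0 1
    have h10 := hcont 1 0
    have h11 := hcont 1 1
    exact (isOpen_lt (h00.sub continuous_const).abs continuous_const).inter
      ((isOpen_lt h01.abs continuous_const).inter
      ((isOpen_lt h10.abs continuous_const).inter
      (isOpen_lt (h11.sub continuous_const).abs continuous_const)))
  refine Filter.mem_of_superset ((QuotientGroup.isOpenMap_coe _ hU).mem_nhds
    ⟨1, by simp [hη], rfl⟩) ?_
  rintro _ ⟨A, hA, rfl⟩
  exact ⟨A, rfl, hA⟩

theorem AgreeOn.act_eq_div {lo hi : ℝ} {f : HomeoR} {p : Proj} (h : AgreeOn lo hi f p)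
    {A : SL(2, ℝ)} (hA : (QuotientGroup.mk A : PSL(2, ℝ)) = p.unop) {x : ℝ}
    (hx : x ∈ Set.Icc lo hi) :
    HomeoR.act x f = (A 0 0 * x + A 0 1) / (A 1 0 * x + A 1 1) := by
  have := h x hx
  rw [Proj.act, ← hA, mk_smul_coe] at this
  split_ifs at this with h0
  · exact absurd this (OnePoint.coe_ne_infty _)
  · exact OnePoint.coe_injective this

theorem exists_isNear_control {lo hi : ℝ} (hI : lo < hi) :
    ∃ η : ℝ, 0 < η ∧ ∀ p : Proj, IsNear η p.unop →
      (∀ x ∈ Set.Icc lo hi, Proj.act (x : ℝ) p ≠ OnePoint.infty) ∧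
      ∀ f : HomeoR, AgreeOn lo hi f p →
        LipschitzOnWith (4 / 3) (fun x => HomeoR.act x f) (Set.Icc lo hi) ∧
        ∀ x ∈ Set.Icc lo hi, |HomeoR.act x f - x| ≤ (hi - lo) / 8 := by
  set M : ℝ := max |lo| |hi|
  have hM0 : 0 ≤ M := (abs_nonneg lo).trans (le_max_left _ _)
  have hL : 0 < hi - lo := sub_pos.2 hI
  -- The first bound keeps denominators at least 7/8 on the interval, so a product of two is at
  -- least 49/64 ≥ 3/4, whence the constant 4/3. The second bounds the numerator of the displacement
  -- by (hi - lo)/16, and division by 7/8 leaves at most (hi - lo)/8.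
  refine ⟨min (1 / (8 * (M + 1))) ((hi - lo) / (16 * (M + 1) ^ 2)), by positivity, ?_⟩
  set η := min (1 / (8 * (M + 1))) ((hi - lo) / (16 * (M + 1) ^ 2)) with hη
  have hη0 : 0 < η := by positivity
  have hη1 : η * (M + 1) ≤ 1 / 8 := by
    have := min_le_left (1 / (8 * (M + 1))) ((hi - lo) / (16 * (M + 1) ^ 2))
    rw [← hη, le_div_iff₀ (by positivity)] at this
    linarith
  have hη2 : η * (M + 1) ^ 2 ≤ (hi - lo) / 16 := by
    have := min_le_right (1 / (8 * (M + 1))) ((hi - lo) / (16 * (M + 1) ^ 2))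
    rw [← hη, le_div_iff₀ (by positivity)] at this
    linarith
  rintro p ⟨A, hA, h00, h01, h10, h11⟩
  have hdet : A 0 0 * A 1 1 - A 0 1 * A 1 0 = 1 := by
    rw [← Matrix.det_fin_two]; exact A.2
  have habs : ∀ x ∈ Set.Icc lo hi, |x| ≤ M := fun x hx => abs_le_max_abs_abs hx.1 hx.2
  have hden : ∀ x ∈ Set.Icc lo hi, |A 1 0 * x + (A 1 1 - 1)| ≤ η * (M + 1) := fun x hx => by
    calc |A 1 0 * x + (A 1 1 - 1)| ≤ |A 1 0 * x| + |A 1 1 - 1| := abs_add_le _ _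
      _ = |A 1 0| * |x| + |A 1 1 - 1| := by rw [abs_mul]
      _ ≤ η * M + η := by gcongr; exact habs x hx
      _ = η * (M + 1) := by ring
  have hpos : ∀ x ∈ Set.Icc lo hi, 7 / 8 ≤ A 1 0 * x + A 1 1 := fun x hx => by
    have := (abs_le.1 (hden x hx)).1
    linarith
  refine ⟨fun x hx => ?_, fun f hf => ?_⟩
  · rw [Proj.act, ← hA, mk_smul_coe, if_neg (by linarith [hpos x hx])]
    exact OnePoint.coe_ne_infty _
  have hval := fun x hx => (hf.act_eq_div hA (x := x) hx)
  refine ⟨LipschitzOnWith.of_dist_le_mul fun x hx y hy => ?_, fun x hx => ?_⟩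
  · have hx' := hpos x hx
    have hy' := hpos y hy
    have hprod : 3 / 4 ≤ (A 1 0 * x + A 1 1) * (A 1 0 * y + A 1 1) := by nlinarith
    have : HomeoR.act x f - HomeoR.act y f =
        (x - y) / ((A 1 0 * x + A 1 1) * (A 1 0 * y + A 1 1)) := by
      rw [hval x hx, hval y hy, div_sub_div _ _ (by linarith) (by linarith)]
      congr 1
      linear_combination (x - y) * hdet
    rw [Real.dist_eq, Real.dist_eq, this, abs_div, abs_of_pos (a := _ * _) (by linarith),
      div_le_iff₀ (by linarith)]
    push_cast
    nlinarith [abs_nonneg (x - y)]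
  · have hx' := hpos x hx
    have hxM := habs x hx
    have : HomeoR.act x f - x =
        ((A 0 0 - 1) * x + A 0 1 - x * (A 1 0 * x + (A 1 1 - 1))) / (A 1 0 * x + A 1 1) := by
      rw [hval x hx]
      rw [eq_div_iff (by linarith), sub_mul, div_mul_cancel₀ _ (by linarith)]
      ring
    rw [this, abs_div, abs_of_pos (by linarith : 0 < A 1 0 * x + A 1 1), div_le_iff₀ (by linarith)]
    calc |(A 0 0 - 1) * x + A 0 1 - x * (A 1 0 * x + (A 1 1 - 1))|
        ≤ |(A 0 0 - 1) * x| + |A 0 1| + |x * (A 1 0 * x + (A 1 1 - 1))| :=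
          (abs_sub _ _).trans (by gcongr; exact abs_add_le _ _)
      _ = |A 0 0 - 1| * |x| + |A 0 1| + |x| * |A 1 0 * x + (A 1 1 - 1)| := by
          rw [abs_mul, abs_mul]
      _ ≤ η * M + η + M * (η * (M + 1)) := by
          gcongr
          exact hden x hx
      _ = η * (M + 1) ^ 2 := by ring
      _ ≤ (hi - lo) / 16 := hη2
      _ ≤ (hi - lo) / 8 * (A 1 0 * x + A 1 1) := by nlinarith

/-- If V met F only in 1, translates of V would isolate every point of F. -/
theorem exists_ne_one_mem_of_nonDiscrete {F : Subgroup Proj} (hF : NonDiscrete F)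
    {V : Set PSL(2, ℝ)} (hV : V ∈ 𝓝 1) : ∃ f ∈ F, f ≠ 1 ∧ f.unop ∈ V := by
  by_contra! hcon
  obtain ⟨U, hUV, hU, h1U⟩ := mem_nhds_iff.1 hV
  refine hF ?_
  let _ : TopologicalSpace F := TopologicalSpace.induced (fun g : F => (g : Proj).unop) pslTopology
  refine discreteTopology_iff_isOpen_singleton.2 fun f => isOpen_induced_iff.2 ?_
  refine ⟨(fun p => p * ((f : Proj).unop)⁻¹) ⁻¹' U, hU.preimage (by fun_prop), ?_⟩
  ext g
  simp only [Set.mem_preimage, Set.mem_singleton_iff]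
  constructor
  · intro hg
    by_contra hne
    refine hcon ((f : Proj)⁻¹ * g) (F.mul_mem (F.inv_mem f.2) g.2) ?_ (hUV (by simpa using hg))
    rw [Ne, inv_mul_eq_one]
    exact fun h => hne (Subtype.ext h.symm)
  · rintro rfl
    simpa using h1U

/-- Fixed points are roots of a polynomial of degree at most two, which vanishes identically only
for a scalar matrix, trivial in PSL(2, ℝ). -/
theorem finite_setOf_act_eq_self {p : Proj} (hp : p ≠ 1) :
    {x : ℝ | Proj.act (x : ℝ) p = (x : ℝ)}.Finite := by
  obtain ⟨A, hA⟩ := QuotientGroup.mk_surjective p.unop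
  open Polynomial in
  have hne : (C (A 1 0) * X ^ 2 + C (A 1 1 - A 0 0) * X + C (-A 0 1) : ℝ[X]) ≠ 0 := by
    intro h0
    have h10 : A 1 0 = 0 := by simpa using congrArg (fun q : ℝ[X] => q.coeff 2) h0
    have h11 : A 1 1 - A 0 0 = 0 := by simpa using congrArg (fun q : ℝ[X] => q.coeff 1) h0
    have h01 : A 0 1 = 0 := by simpa using congrArg (fun q : ℝ[X] => q.coeff 0) h0
    have hdet : A 0 0 * A 1 1 - A 0 1 * A 1 0 = 1 := by
      rw [← Matrix.det_fin_two]; exact A.2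
    refine hp (MulOpposite.unop_injective ?_)
    rw [← hA, MulOpposite.unop_one, QuotientGroup.eq_one_iff,
      Matrix.SpecialLinearGroup.mem_center_iff]
    refine ⟨A 0 0, ?_, ?_⟩
    · rw [Fintype.card_fin]
      rw [h01, sub_eq_zero.1 h11] at hdet
      linarith
    · ext i j
      fin_cases i <;> fin_cases j <;> simp [h10, h01, sub_eq_zero.1 h11]
  refine (Polynomial.finite_setOfPred_isRoot hne).subset fun x hx => ?_
  rw [Set.mem_ofPred_eq, Proj.act, ← hA, mk_smul_coe] at hx
  split_ifs at hx with h0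
  · exact absurd hx (OnePoint.infty_ne_coe _)
  · have := OnePoint.coe_injective hx
    rw [div_eq_iff h0] at this
    simp only [Set.mem_ofPred_eq, Polynomial.IsRoot.def, Polynomial.eval_add, Polynomial.eval_mul,
      Polynomial.eval_C, Polynomial.eval_pow, Polynomial.eval_X]
    linear_combination -this

theorem measurableSet_setOf_coe_eq_act {f : ℝ → ℝ} (hf : Measurable f) (p : Proj) :
    MeasurableSet {x : ℝ | (f x : OnePoint ℝ) = Proj.act (x : ℝ) p} := by
  obtain ⟨A, hA⟩ := QuotientGroup.mk_surjective p.unop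
  have : {x : ℝ | (f x : OnePoint ℝ) = Proj.act (x : ℝ) p} =
      {x : ℝ | A 1 0 * x + A 1 1 = 0}ᶜ ∩
        {x : ℝ | f x = (A 0 0 * x + A 0 1) / (A 1 0 * x + A 1 1)} := by
    ext x
    simp only [Set.mem_ofPred_eq, Proj.act, ← hA, mk_smul_coe, Set.mem_inter_iff,
      Set.mem_compl_iff]
    split_ifs with h0
    · simp [h0]
    · simp [h0]
  rw [this]
  exact (measurableSet_eq_fun (by fun_prop) (by fun_prop)).compl.inter
    (measurableSet_eq_fun hf (by fun_prop))

end PiecewiseProjective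

/-! ### The measure count. -/

namespace PiecewiseProjective

open MeasureTheory

/-- By the intermediate value theorem, the image of the interval misses at most a margin of length
(hi - lo)/8 at each end. The rest of X lies in the image of its preimage, and f expands measure by
at most 4/3. -/
theorem volume_real_le_of_lipschitzOnWith {lo hi : ℝ} (hI : lo < hi) {f : ℝ → ℝ}
    (hlip : LipschitzOnWith (4 / 3) f (Set.Icc lo hi))
    (hclose : ∀ x ∈ Set.Icc lo hi, |f x - x| ≤ (hi - lo) / 8) {X : Set ℝ}
    (hX : X ⊆ Set.Icc lo hi) :
    volume.real X ≤ 4 / 3 * volume.real {x | x ∈ Set.Icc lo hi ∧ f x ∈ X} + (hi - lo) / 4 := by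
  set Z := {x | x ∈ Set.Icc lo hi ∧ f x ∈ X}
  have hZ : Z ⊆ Set.Icc lo hi := fun x hx => hx.1
  have hZfin : volume Z ≠ ⊤ := measure_ne_top_of_subset hZ measure_Icc_lt_top.ne
  have himage : volume (f '' Z) ≤ ENNReal.ofReal (4 / 3) * volume Z := by
    have := (hlip.mono hZ).hausdorffMeasure_image_le zero_le_one
    rw [hausdorffMeasure_real, ENNReal.rpow_one] at this
    convert this using 2
    rw [ENNReal.ofReal, Real.toNNReal_div (by norm_num)]
    simp
  have himage_fin : volume (f '' Z) ≠ ⊤ :=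
    ne_top_of_le_ne_top (ENNReal.mul_ne_top ENNReal.ofReal_ne_top hZfin) himage
  have himage' : volume.real (f '' Z) ≤ 4 / 3 * volume.real Z := by
    have := ENNReal.toReal_mono (ENNReal.mul_ne_top ENNReal.ofReal_ne_top hZfin) himage
    rwa [ENNReal.toReal_mul, ENNReal.toReal_ofReal (by norm_num)] at this
  set J₁ := Set.Icc lo (lo + (hi - lo) / 8)
  set J₂ := Set.Icc (hi - (hi - lo) / 8) hi
  have hcover : X ⊆ f '' Z ∪ (J₁ ∪ J₂) := by
    intro x hx
    by_cases h1 : x ≤ lo + (hi - lo) / 8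
    · exact Or.inr (Or.inl ⟨(hX hx).1, h1⟩)
    by_cases h2 : hi - (hi - lo) / 8 ≤ x
    · exact Or.inr (Or.inr ⟨h2, (hX hx).2⟩)
    have hlo := (abs_le.1 (hclose lo (Set.left_mem_Icc.2 hI.le))).2
    have hhi := (abs_le.1 (hclose hi (Set.right_mem_Icc.2 hI.le))).1
    obtain ⟨y, hy, rfl⟩ := intermediate_value_Icc hI.le hlip.continuousOn
      (show x ∈ Set.Icc (f lo) (f hi) from ⟨by linarith, by linarith⟩)
    exact Or.inl ⟨y, ⟨hy, hx⟩, rfl⟩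
  have hJ₁ : volume.real J₁ = (hi - lo) / 8 := by
    rw [Real.volume_real_Icc_of_le (by linarith)]; ring
  have hJ₂ : volume.real J₂ = (hi - lo) / 8 := by
    rw [Real.volume_real_Icc_of_le (by linarith)]; ring
  have hfin : volume (f '' Z ∪ (J₁ ∪ J₂)) ≠ ⊤ :=
    measure_union_ne_top himage_fin
      (measure_union_ne_top measure_Icc_lt_top.ne measure_Icc_lt_top.ne)
  calc volume.real X ≤ volume.real (f '' Z ∪ (J₁ ∪ J₂)) := measureReal_mono hcover hfin
    _ ≤ volume.real (f '' Z) + volume.real (J₁ ∪ J₂) := measureReal_union_le _ _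
    _ ≤ volume.real (f '' Z) + (volume.real J₁ + volume.real J₂) := by
      gcongr; exact measureReal_union_le _ _
    _ ≤ 4 / 3 * volume.real Z + (hi - lo) / 4 := by rw [hJ₁, hJ₂]; linarith

theorem evalWord_mul (a b : Proj) (v w : FreeGroup (Fin 2)) :
    evalWord a b (v * w) = evalWord a b v * evalWord a b w := map_mul _ _ _

theorem HomeoR.measurable_act (f : HomeoR) : Measurable fun x => HomeoR.act x f :=
  f.unop.continuous.measurable

/-- The points of the real line that no nontrivial word fixes. -/
def generic (a b : Proj) : Set ℝ :=
  {x | ∀ w : FreeGroup (Fin 2), Proj.act (x : ℝ) (evalWord a b w) = (x : ℝ) → w = 1}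

theorem countable_compl_generic {a b : Proj}
    (hinj : Function.Injective (evalWord a b)) : (generic a b)ᶜ.Countable := by
  have : (generic a b)ᶜ ⊆ ⋃ w ∈ {w : FreeGroup (Fin 2) | w ≠ 1},
      {x : ℝ | Proj.act (x : ℝ) (evalWord a b w) = (x : ℝ)} := by
    intro x hx
    simp only [generic, Set.mem_compl_iff, Set.mem_ofPred_eq, not_forall] at hx
    obtain ⟨w, hw, hne⟩ := hx
    exact Set.mem_biUnion hne hw
  refine (Set.Countable.biUnion (Set.to_countable _) fun w hw => ?_).mono this
  refine (finite_setOf_act_eq_self fun h => hw (hinj ?_)).countable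
  rw [h]; exact (map_one (FreeGroup.lift ![a, b])).symm

/-- The points that `f` and the word `w` move to the same point. -/
def coincidence (a b : Proj) (f : HomeoR) (w : FreeGroup (Fin 2)) : Set ℝ :=
  {x | ((HomeoR.act x f : ℝ) : OnePoint ℝ) = Proj.act (x : ℝ) (evalWord a b w)}

theorem measurableSet_coincidence (a b : Proj) (f : HomeoR) (w : FreeGroup (Fin 2)) :
    MeasurableSet (coincidence a b f w) :=
  measurableSet_setOf_coe_eq_act (HomeoR.measurable_act f) _

/-- The generic points `x` of `[lo, hi]` such that, for the first `k₀ ∈ u` for which `x · k k₀⁻¹`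
lies in the orbit of `x` under words, `x · k k₀⁻¹ = x · w` with a word `w` that does not start with
a power of the generator `c`. -/
def piece (a b : Proj) (lo hi : ℝ) (u : Finset HomeoR) (rank : HomeoR → ℕ) (c : Fin 2)
    (k : HomeoR) : Set ℝ :=
  Set.Icc lo hi ∩ generic a b ∩ ⋃ k₀ ∈ u, (⋃ w ∈ {w | NotStart c w}, coincidence a b (k * k₀⁻¹) w) ∩
    ⋂ k₁ ∈ {k₁ | k₁ ∈ u ∧ rank k₁ < rank k₀}, ⋂ w, (coincidence a b (k * k₁⁻¹) w)ᶜ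

theorem mem_piece {a b : Proj} {lo hi : ℝ} {u : Finset HomeoR} {rank : HomeoR → ℕ} {c : Fin 2}
    {k : HomeoR} {x : ℝ} : x ∈ piece a b lo hi u rank c k ↔
      (x ∈ Set.Icc lo hi ∧ x ∈ generic a b) ∧ ∃ k₀ ∈ u,
        (∃ w, NotStart c w ∧ x ∈ coincidence a b (k * k₀⁻¹) w) ∧
        ∀ k₁ ∈ u, rank k₁ < rank k₀ → ∀ w, x ∉ coincidence a b (k * k₁⁻¹) w := by
  simp only [piece, Set.mem_inter_iff, Set.mem_iUnion, Set.mem_iInter, Set.mem_compl_iff,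
    Set.mem_ofPred_eq, exists_prop, and_imp]

theorem measurableSet_piece {a b : Proj} (hinj : Function.Injective (evalWord a b)) (lo hi : ℝ)
    (u : Finset HomeoR) (rank : HomeoR → ℕ) (c : Fin 2) (k : HomeoR) :
    MeasurableSet (piece a b lo hi u rank c k) := by
  have hgen : MeasurableSet (generic a b) :=
    (countable_compl_generic hinj).measurableSet.of_compl
  refine (measurableSet_Icc.inter hgen).inter (Finset.measurableSet_biUnion _ fun k₀ _ => ?_)
  refine (MeasurableSet.biUnion (Set.to_countable _) fun w _ =>
    measurableSet_coincidence _ _ _ _).inter ?_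
  exact MeasurableSet.biInter (u.finite_toSet.subset fun k hk => hk.1).countable fun k₁ _ =>
    MeasurableSet.iInter fun w => (measurableSet_coincidence _ _ _ _).compl

theorem Icc_inter_generic_subset_piece (a b : Proj) (lo hi : ℝ) {u : Finset HomeoR}
    (rank : HomeoR → ℕ) {k : HomeoR} (hk : k ∈ u) :
    Set.Icc lo hi ∩ generic a b ⊆
      piece a b lo hi u rank 0 k ∪ piece a b lo hi u rank 1 k := by
  classical
  intro x hx
  have hne : (u.filter fun k₀ => ∃ w, x ∈ coincidence a b (k * k₀⁻¹) w).Nonempty := by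
    -- A first k₀ exists because k itself qualifies, with the trivial word.
    refine ⟨k, Finset.mem_filter.2 ⟨hk, 1, ?_⟩⟩
    rw [mul_inv_cancel]
    change _ = Proj.act _ (FreeGroup.lift ![a, b] 1)
    rw [map_one]
    exact (one_smul PSL(2, ℝ) (x : OnePoint ℝ)).symm
  obtain ⟨k₀, hk₀, hmin⟩ := Finset.exists_min_image _ rank hne
  obtain ⟨hk₀u, w, hw⟩ := Finset.mem_filter.1 hk₀
  have hfirst : ∀ k₁ ∈ u, rank k₁ < rank k₀ → ∀ w, x ∉ coincidence a b (k * k₁⁻¹) w :=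
    fun k₁ hk₁ hlt w' hw' =>
      hlt.not_ge (hmin k₁ (Finset.mem_filter.2 ⟨hk₁, w', hw'⟩))
  rcases notStart_zero_or_one w with h | h
  · exact Or.inl (mem_piece.2 ⟨hx, k₀, hk₀u, ⟨w, h, hw⟩, hfirst⟩)
  · exact Or.inr (mem_piece.2 ⟨hx, k₀, hk₀u, ⟨w, h, hw⟩, hfirst⟩)

theorem le_volume_real_piece_add {a b : Proj} (hinj : Function.Injective (evalWord a b))
    {lo hi : ℝ} (hI : lo < hi) {u : Finset HomeoR} (rank : HomeoR → ℕ) {k : HomeoR} (hk : k ∈ u) :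
    hi - lo ≤ volume.real (piece a b lo hi u rank 0 k) +
      volume.real (piece a b lo hi u rank 1 k) := by
  have hfin : ∀ c, volume (piece a b lo hi u rank c k) ≠ ⊤ := fun c =>
    measure_ne_top_of_subset (fun x hx => (mem_piece.1 hx).1.1) measure_Icc_lt_top.ne
  have hnull : volume (generic a b)ᶜ = 0 := (countable_compl_generic hinj).measure_zero _
  calc hi - lo = volume.real (Set.Icc lo hi) := (Real.volume_real_Icc_of_le hI.le).symm
    _ = volume.real (Set.Icc lo hi ∩ generic a b) := by
      rw [Measure.real, Measure.real, measure_inter_conull hnull]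
    _ ≤ volume.real (piece a b lo hi u rank 0 k ∪ piece a b lo hi u rank 1 k) :=
      measureReal_mono (Icc_inter_generic_subset_piece a b lo hi rank hk)
        (measure_union_ne_top (hfin 0) (hfin 1))
    _ ≤ _ := measureReal_union_le _ _

theorem mul_eq_mul_of_mem_piece {a b : Proj} {lo hi : ℝ} {u : Finset HomeoR} {rank : HomeoR → ℕ}
    (hrank : Set.InjOn rank u) {t₁ t₂ k₁ k₂ : HomeoR} {v₁ v₂ : FreeGroup (Fin 2)} {c₁ c₂ : Fin 2}
    {x : ℝ} (hk : t₁ * k₁ = t₂ * k₂)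
    (h₁ : ((HomeoR.act x t₁ : ℝ) : OnePoint ℝ) = Proj.act (x : ℝ) (evalWord a b v₁))
    (h₂ : ((HomeoR.act x t₂ : ℝ) : OnePoint ℝ) = Proj.act (x : ℝ) (evalWord a b v₂))
    (hx₁ : HomeoR.act x t₁ ∈ piece a b lo hi u rank c₁ k₁)
    (hx₂ : HomeoR.act x t₂ ∈ piece a b lo hi u rank c₂ k₂) :
    ∃ w₁ w₂, NotStart c₁ w₁ ∧ NotStart c₂ w₂ ∧ v₁ * w₁ = v₂ * w₂ := by
  obtain ⟨⟨-, hgen⟩, p₁, hp₁, ⟨w₁, hn₁, hw₁⟩, hmin₁⟩ := mem_piece.1 hx₁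
  obtain ⟨-, p₂, hp₂, ⟨w₂, hn₂, hw₂⟩, hmin₂⟩ := mem_piece.1 hx₂
  have key : ∀ {t k : HomeoR} {v : FreeGroup (Fin 2)},
      ((HomeoR.act x t : ℝ) : OnePoint ℝ) = Proj.act (x : ℝ) (evalWord a b v) →
      ∀ p w, HomeoR.act x t ∈ coincidence a b (k * p⁻¹) w ↔
        x ∈ coincidence a b (t * k * p⁻¹) (v * w) := by
    intro t k v h p w
    simp only [coincidence, Set.mem_ofPred_eq, evalWord_mul, Proj.act_mul, h, HomeoR.act_mul]
  rw [key h₁] at hw₁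
  rw [key h₂, ← hk] at hw₂
  -- Both are the first element p of u for which x·t₁k₁p⁻¹ lies in the orbit of x: moving between x
  -- and x·t_j only multiplies the word by v_j.
  have hp : p₁ = p₂ := by
    refine hrank hp₁ hp₂ (le_antisymm (not_lt.1 fun hlt => ?_) (not_lt.1 fun hlt => ?_))
    · refine hmin₁ p₂ hp₂ hlt (v₁⁻¹ * (v₂ * w₂)) ?_
      rwa [key h₁, mul_inv_cancel_left]
    · refine hmin₂ p₁ hp₁ hlt (v₂⁻¹ * (v₁ * w₁)) ?_
      rwa [key h₂, mul_inv_cancel_left, ← hk]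
  subst hp
  refine ⟨w₁, w₂, hn₁, hn₂, ?_⟩
  have hact : Proj.act (x : ℝ) (evalWord a b (v₁ * w₁)) =
      Proj.act (x : ℝ) (evalWord a b (v₂ * w₂)) := hw₁.symm.trans hw₂
  -- Genericity is available at x·t₁ = x·v₁, so the word fixing x is conjugated by v₁.
  have hfix := hgen (w₁ * (v₂ * w₂)⁻¹ * v₁) (by
    rw [h₁, ← Proj.act_mul, ← evalWord_mul,
      show v₁ * (w₁ * (v₂ * w₂)⁻¹ * v₁) = v₁ * w₁ * ((v₂ * w₂)⁻¹ * v₁) by group,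
      evalWord_mul, Proj.act_mul, hact, ← Proj.act_mul, ← evalWord_mul]
    congr 2
    group)
  have : v₁ * w₁ * (v₂ * w₂)⁻¹ = 1 := by
    have := congrArg (fun z => v₁ * z * v₁⁻¹) hfix
    simpa [mul_assoc] using this
  exact mul_inv_eq_one.1 this

/-- If the homeomorphisms `t c i` agree on `[lo, hi]` with the words `v c i`, `c ∈ {a, b}`, and move
the points of that interval little, then multiplication by them at least doubles finite sets. -/
theorem two_mul_card_le_card_of_agreeOn {a b : Proj} (hinj : Function.Injective (evalWord a b))
    {lo hi : ℝ} (hI : lo < hi) {v : Fin 2 → Fin 6 → FreeGroup (Fin 2)}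
    (hv : ∀ c, IsConjFamily c (v c)) {t : Fin 2 → Fin 6 → HomeoR}
    (hagree : ∀ c i, AgreeOn lo hi (t c i) (evalWord a b (v c i)))
    (hlip : ∀ c i, LipschitzOnWith (4 / 3) (fun x => HomeoR.act x (t c i)) (Set.Icc lo hi))
    (hclose : ∀ c i, ∀ x ∈ Set.Icc lo hi, |HomeoR.act x (t c i) - x| ≤ (hi - lo) / 8)
    (u s : Finset HomeoR) (hs : ∀ c i, ∀ k ∈ u, t c i * k ∈ s) : 2 * u.card ≤ s.card := by
  classical
  obtain ⟨rank, hrank⟩ : ∃ rank : HomeoR → ℕ, Set.InjOn rank u :=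
    Set.countable_iff_exists_injOn.1 u.finite_toSet.countable
  set Z : Fin 2 × Fin 6 × HomeoR → Set ℝ := fun z =>
    {x | x ∈ Set.Icc lo hi ∧ HomeoR.act x (t z.1 z.2.1) ∈ piece a b lo hi u rank z.1 z.2.2} with hZ
  have hL : 0 < hi - lo := sub_pos.2 hI
  have hZmeas : ∀ z, MeasurableSet (Z z) := fun z => measurableSet_Icc.inter
    (HomeoR.measurable_act _ (measurableSet_piece hinj lo hi u rank z.1 z.2.2))
  have hZvol : ∀ z, volume.real (piece a b lo hi u rank z.1 z.2.2) ≤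
      4 / 3 * volume.real (Z z) + (hi - lo) / 4 := fun z =>
    volume_real_le_of_lipschitzOnWith hI (hlip _ _) (hclose _ _) fun x hx => (mem_piece.1 hx).1.1
  have hdisj : ∀ z z' : Fin 2 × Fin 6 × HomeoR,
      t z.1 z.2.1 * z.2.2 = t z'.1 z'.2.1 * z'.2.2 → z ≠ z' → Disjoint (Z z) (Z z') := by
    rintro ⟨c₁, i₁, k₁⟩ ⟨c₂, i₂, k₂⟩ hk hne
    refine Set.disjoint_left.2 fun x hx hx' => hne ?_
    obtain ⟨w₁, w₂, hn₁, hn₂, hw⟩ := mul_eq_mul_of_mem_piece hrank hk (hagree c₁ i₁ x hx.1)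
      (hagree c₂ i₂ x hx.1) hx.2 hx'.2
    have hhead := (hv c₁).head?_toWord_mul i₁ hn₁
    rw [hw, (hv c₂).head?_toWord_mul i₂ hn₂] at hhead
    obtain rfl : c₁ = c₂ := by simpa using hhead.symm
    obtain ⟨rfl, -⟩ := (hv c₁).eq_of_mul_eq hn₁ hn₂ hw
    obtain rfl : k₁ = k₂ := mul_left_cancel hk
    rfl
  set Q : Finset (Fin 2 × Fin 6 × HomeoR) := Finset.univ ×ˢ Finset.univ ×ˢ u with hQ
  have hupper : ∑ z ∈ Q, volume.real (Z z) ≤ s.card * (hi - lo) := by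
    rw [← Finset.sum_fiberwise_of_maps_to (s := Q) (t := s) (g := fun z => t z.1 z.2.1 * z.2.2)
      (fun z hz => hs _ _ _ (by simpa [hQ] using hz)), ← nsmul_eq_mul]
    refine Finset.sum_le_card_nsmul _ _ _ fun l _ => ?_
    rw [← measureReal_biUnion_finset (fun z hz z' hz' hne => hdisj z z'
      ((Finset.mem_filter.1 hz).2.trans (Finset.mem_filter.1 hz').2.symm) hne)
      (fun z _ => hZmeas z)
      (fun z _ => measure_ne_top_of_subset (fun x hx => hx.1) measure_Icc_lt_top.ne),
      ← Real.volume_real_Icc_of_le hI.le]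
    exact measureReal_mono (Set.iUnion₂_subset fun z _ x hx => hx.1) measure_Icc_lt_top.ne
  have hlower : (u.card : ℝ) * (9 / 4 * (hi - lo)) ≤ ∑ z ∈ Q, volume.real (Z z) := by
    rw [hQ, Finset.sum_product, Fin.sum_univ_two, Finset.sum_product_right,
      Finset.sum_product_right, ← Finset.sum_add_distrib, ← nsmul_eq_mul]
    refine Finset.card_nsmul_le_sum _ _ _ fun k hk => ?_
    have hsum := le_volume_real_piece_add hinj hI rank hk
    have h6 : ∀ c : Fin 2, 6 * (3 / 4 * (volume.real (piece a b lo hi u rank c k) -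
        (hi - lo) / 4)) ≤ ∑ i : Fin 6, volume.real (Z (c, i, k)) := fun c => by
      have := Finset.card_nsmul_le_sum (Finset.univ : Finset (Fin 6))
        (fun i => volume.real (Z (c, i, k)))
        (3 / 4 * (volume.real (piece a b lo hi u rank c k) - (hi - lo) / 4))
        fun i _ => by have := hZvol (c, i, k); dsimp only at this ⊢; linarith
      simpa using this
    linarith [h6 0, h6 1]
  have h := hlower.trans hupper
  have h' : (u.card : ℝ) * (9 / 4) ≤ s.card := by
    rw [← mul_assoc] at h
    exact le_of_mul_le_mul_right h hL
  have hpos : (0 : ℝ) ≤ u.card := Nat.cast_nonneg _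
  exact_mod_cast (show (2 : ℝ) * u.card ≤ s.card by linarith)

end PiecewiseProjective

/-! ### Small conjugate families from non-discreteness, and the theorem. -/

namespace PiecewiseProjective

open Topology

theorem FreelyGeneratedBy.exists_evalWord_eq {F : Subgroup Proj} {a b : Proj}
    (h : FreelyGeneratedBy F a b) {f : Proj} (hf : f ∈ F) : ∃ w, evalWord a b w = f := by
  have hr : (FreeGroup.lift ![a, b]).range = F := by
    rw [← h.generates, FreeGroup.range_lift_eq_closure]
    simp [Set.pair_comm]
  rw [← hr] at hf
  exact hf

theorem conj_mem_nhds_one {V : Set PSL(2, ℝ)} (hV : V ∈ 𝓝 1) (r : Proj) :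
    {p : PSL(2, ℝ) | (r * MulOpposite.op p * r⁻¹).unop ∈ V} ∈ 𝓝 1 := by
  have hc : Continuous fun p : PSL(2, ℝ) => (r * MulOpposite.op p * r⁻¹).unop := by
    simp only [MulOpposite.unop_mul, MulOpposite.unop_op]
    fun_prop
  refine hc.continuousAt.preimage_mem_nhds ?_
  simpa using hV

/-- A non-discrete free group has families of conjugates `c ^ i w c ^ (-i)` arbitrarily close to
the identity. -/
theorem exists_isConjFamily_mem {F : Subgroup Proj} {a b : Proj} (hfree : FreelyGeneratedBy F a b)
    (hF : NonDiscrete F) {V : Set PSL(2, ℝ)} (hV : V ∈ 𝓝 1) {c d : Fin 2} (hcd : d ≠ c) :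
    ∃ g : Fin 6 → FreeGroup (Fin 2), IsConjFamily c g ∧ ∀ i, (evalWord a b (g i)).unop ∈ V := by
  let S : Set (FreeGroup (Fin 2)) := {1, FreeGroup.mk [(d, true)], FreeGroup.mk [(d, false)]}
  have hS : S.Finite := by simp [S]
  let r : Fin 6 → FreeGroup (Fin 2) → FreeGroup (Fin 2) := fun i q =>
    FreeGroup.of c ^ (i.val + 1) * q
  -- The letter q depends on the word v, which is yet to be chosen, so the neighbourhood must work
  -- for all three candidates at once.
  have hW : (⋂ i : Fin 6, ⋂ q ∈ S, {p : PSL(2, ℝ) |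
      (evalWord a b (r i q) * MulOpposite.op p * (evalWord a b (r i q))⁻¹).unop ∈ V}) ∈
        𝓝 (1 : PSL(2, ℝ)) :=
    Filter.iInter_mem.2 fun i => (Filter.biInter_mem hS).2 fun q _ => conj_mem_nhds_one hV _
  obtain ⟨f, hfF, hf1, hf⟩ := exists_ne_one_mem_of_nonDiscrete hF hW
  obtain ⟨v, rfl⟩ := hfree.exists_evalWord_eq hfF
  have hv : v ≠ 1 := by
    rintro rfl
    exact hf1 (map_one (FreeGroup.lift ![a, b]))
  obtain ⟨q, hq, hfam⟩ := exists_isConjFamily hcd hv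
  refine ⟨_, hfam, fun i => ?_⟩
  have := Set.mem_iInter₂.1 (Set.mem_iInter.1 hf i) q hq
  simpa [r, evalWord] using this

end PiecewiseProjective

open PiecewiseProjective in
theorem mainTheorem3
    (H : Subgroup PiecewiseProjective.HomeoR) [Countable H] [DecidableEq H]
    (hH : ∀ f ∈ H, PiecewiseProjective.IsPiecewiseProjective f)
    (F : Subgroup PiecewiseProjective.Proj) (a b : PiecewiseProjective.Proj)
    (hfree : PiecewiseProjective.FreelyGeneratedBy F a b)
    (hF : PiecewiseProjective.NonDiscrete F)
    (m : MetricSpace PSL(2, ℝ))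
    (hm : m.toUniformSpace.toTopologicalSpace = PiecewiseProjective.pslTopology)
    (lo hi : ℝ) (hI : lo < hi) :
    ∃ δ : ℝ, 0 < δ ∧
      (∃ g h : Fin 6 → FreeGroup (Fin 2),
        PiecewiseProjective.IsWordChoice m a b lo hi δ g h) ∧
      ∀ g h : Fin 6 → FreeGroup (Fin 2),
        PiecewiseProjective.IsWordChoice m a b lo hi δ g h →
        ∀ g' h' : Fin 6 → H,
          (∀ i, PiecewiseProjective.AgreeOn lo hi (g' i)
            (PiecewiseProjective.evalWord a b (g i))) →
          (∀ i, PiecewiseProjective.AgreeOn lo hi (h' i)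
            (PiecewiseProjective.evalWord a b (h i))) →
          ∀ u : Finset H,
            2 * u.card ≤
              (((Finset.univ.image g' ∪ Finset.univ.image h') ∪ {1}) * u).card := by
  obtain ⟨η, hη, hcontrol⟩ := exists_isNear_control hI
  have hbasis : (@nhds _ pslTopology (1 : PSL(2, ℝ))).HasBasis (fun ε : ℝ => 0 < ε)
      fun ε => {p | m.dist p 1 < ε} := by
    rw [← hm]
    exact @Metric.nhds_basis_ball _ m.toPseudoMetricSpace 1
  obtain ⟨δ, hδ, hball⟩ := hbasis.mem_iff.1 (isNear_mem_nhds_one hη)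
  have hV := hbasis.mem_of_mem hδ
  have hreg : ∀ w, m.dist (evalWord a b w).unop 1 < δ →
      ∀ x ∈ Set.Icc lo hi, Proj.act (x : ℝ) (evalWord a b w) ≠ OnePoint.infty :=
    fun w hw => (hcontrol _ (hball hw)).1
  refine ⟨δ, hδ, ?_, ?_⟩
  · obtain ⟨g, hg, hgV⟩ := exists_isConjFamily_mem hfree hF hV (c := 0) (d := 1) (by simp)
    obtain ⟨h, hh, hhV⟩ := exists_isConjFamily_mem hfree hF hV (c := 1) (d := 0) (by simp)
    exact ⟨g, h, hg, hh, hgV, hhV, fun i => hreg _ (hgV i), fun i => hreg _ (hhV i)⟩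
  · intro g h hT g' h' hg' hh' u
    have hsmall : ∀ c i, m.dist (evalWord a b (![g, h] c i)).unop 1 < δ :=
      Fin.forall_fin_two.2 ⟨hT.small_g, hT.small_h⟩
    have hagree : ∀ c i, AgreeOn lo hi ((![g', h'] c i : H) : HomeoR)
        (evalWord a b (![g, h] c i)) := Fin.forall_fin_two.2 ⟨hg', hh'⟩
    have hnear := fun c i => (hcontrol _ (hball (hsmall c i))).2 _ (hagree c i)
    have := two_mul_card_le_card_of_agreeOn (v := ![g, h]) hfree.free hI
      (Fin.forall_fin_two.2 ⟨hT.form_g, hT.form_h⟩) hagree (fun c i => (hnear c i).1)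
      (fun c i => (hnear c i).2) (u.map (Function.Embedding.subtype _))
      ((((Finset.univ.image g' ∪ Finset.univ.image h') ∪ {1}) * u).map
        (Function.Embedding.subtype _)) (by
        intro c i k hk
        obtain ⟨l, hl, rfl⟩ := Finset.mem_map.1 hk
        refine Finset.mem_map.2 ⟨![g', h'] c i * l, Finset.mul_mem_mul ?_ hl, rfl⟩
        fin_cases c <;> simp)
    simpa using this
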